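/- Let $K$ be a field and $S=K[x_1,\dots,x_n]$ with graded maximal ideal $\mathfrak m=(x_1,\dots,x_n)$. Fix positive integers $d$ and $e_1,\dots,e_n$ with $1\le e_1\le\cdots\le e_n\le d$, and put $t=d+n-1-\sum_{i=1}^n e_i$. Let $I=I_{(d;e_1,\dots,e_n)}$ be the ideal of Veronese type, i.e. the ideal of $S$ generated by the monomials $x_1^{a_1}\cdots x_n^{a_n}$ of degree $d$ with $a_i\le e_i$ for all $1\le i\le n$. Then $$\operatorname{depth} S/I=\min\{\,n,\ \max\{0,t\}\,\},$$ where the depth is the maximal length of an $S/I$-regular sequence of elements of $\mathfrak m$. In particular, $\operatorname{depth} S/I=t$ whenever $0\le t\le n$; the depth is $0$ if $t<0$, and if $t>n$ then $I=0$ and the depth is $n$. -/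

import Mathlib

/-- The depth (grade) of the `R`-module `M` with respect to the ideal `J`: the supremum of the
lengths of the `M`-regular sequences consisting of elements of `J`. For a finitely generated graded
module over a polynomial ring over a field, with `J` the graded maximal ideal, this is the
depth of `M`. -/
noncomputable def moduleDepth {R : Type*} [CommRing R] (J : Ideal R)
    (M : Type*) [AddCommGroup M] [Module R M] : ℕ∞ :=
  ⨆ rs : {rs : List R // (∀ r ∈ rs, r ∈ J) ∧ RingTheory.Sequence.IsRegular M rs},
    (rs.1.length : ℕ∞)

/-- The ideal of Veronese type of `K[x_1, …, x_n]` indexed by `d` and `(e_1, …, e_n)`: it is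
generated by the monomials `x_1^{a_1} ⋯ x_n^{a_n}` of degree `d` with `a_i ≤ e_i` for all `i`. -/
noncomputable def veroneseTypeIdeal (K : Type*) [Field K] {n : ℕ} (d : ℕ) (e : Fin n → ℕ) :
    Ideal (MvPolynomial (Fin n) K) :=
  Ideal.span {u | ∃ a : Fin n →₀ ℕ,
    ∑ i, a i = d ∧ (∀ i, a i ≤ e i) ∧ u = MvPolynomial.monomial a 1}

/-! Write `k` for the claimed depth and `m` for the graded maximal ideal. Upper bound: for a set `A`
of `n - k` variables there is a monomial `x^b` with `I : x^b = (x_i : i ∈ A)`, so this prime, of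
height at least `n - k`, is associated to `S/I`. Dividing by a regular element of `m` replaces an
associated prime inside `m` by a strictly larger one (`exists_prime_colon_gt`). Heights in `S` are
at most `n`, so a regular sequence has length at most `k`. Lower bound: the complete homogeneous
polynomials `h_1, …, h_k` form a regular sequence (`regularModulo_veroneseTypeIdeal`). The induction
on `n` treats any window `h_{s+1}, …, h_{s+r}`. With `X = x_0`, membership in `I` says that the
coefficient of `X^j` lies in the Veronese type ideal `c_j` of degree `d - min j e_0` in the other
variables. Filtering by powers of `X` leaves the quotients `R/c_j` for `j < e_0`, and
`(R/c_{e_0})[X]`. On the latter `h_{s+1}` is monic in `X`, hence regular, and modulo it the rest of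
the window loses `X` through `h_{k+1}(X, l) = h_{k+1}(l) + X h_k(X, l)`. So the last quotient needs
one regular element fewer. -/

/-- The sequence `rs` is weakly regular on `R ⧸ I`, phrased in terms of ideals of `R`. -/
def Ideal.RegularModulo {R : Type*} [CommRing R] : Ideal R → List R → Prop
  | _, [] => True
  | I, r :: rs => (∀ p, r * p ∈ I → p ∈ I) ∧ (I ⊔ Ideal.span {r}).RegularModulo rs

namespace Ideal

variable {R : Type*} [CommRing R]

theorem regularModulo_iff_getElem (I : Ideal R) (rs : List R) :
    I.RegularModulo rs ↔ ∀ (i : ℕ) (h : i < rs.length) (p : R),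
      rs[i] * p ∈ I ⊔ Ideal.ofList (rs.take i) → p ∈ I ⊔ Ideal.ofList (rs.take i) := by
  induction rs generalizing I with
  | nil => simp [RegularModulo]
  | cons r rs ih =>
    rw [RegularModulo, ih]
    constructor
    · rintro ⟨h0, h1⟩ i hi p
      cases i with
      | zero => simpa using h0 p
      | succ i => simpa [Ideal.ofList_cons, sup_assoc] using h1 i (by simpa using hi) p
    · intro h
      refine ⟨fun p hp => ?_, fun i hi p => ?_⟩
      · have := h 0 (Nat.succ_pos _) p
        simp only [List.getElem_cons_zero, List.take_zero, Ideal.ofList_nil, sup_bot_eq] at this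
        exact this hp
      · have := h (i + 1) (Nat.succ_lt_succ hi) p
        simp only [List.getElem_cons_succ, List.take_succ_cons, Ideal.ofList_cons] at this
        rwa [sup_assoc]

theorem mk_mem_smul_top_iff (I J : Ideal R) (p : R) :
    (Ideal.Quotient.mk I p) ∈ (J • ⊤ : Submodule R (R ⧸ I)) ↔ p ∈ I ⊔ J := by
  have h : (J • ⊤ : Submodule R (R ⧸ I)) = Submodule.map (Submodule.mkQ I) J := by
    rw [← Submodule.range_mkQ I, ← Submodule.map_top, ← Submodule.map_smul'']
    simp
  rw [h]
  have := Submodule.comap_map_mkQ I J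
  rw [← this]
  rfl

theorem isWeaklyRegular_quotient_iff (I : Ideal R) (rs : List R) :
    RingTheory.Sequence.IsWeaklyRegular (R ⧸ I) rs ↔ I.RegularModulo rs := by
  rw [regularModulo_iff_getElem, RingTheory.Sequence.isWeaklyRegular_iff]
  refine forall₂_congr fun i hi => ?_
  rw [isSMulRegular_iff_right_eq_zero_of_smul]
  rw [(Submodule.mkQ_surjective _).forall, Ideal.Quotient.mk_surjective.forall]
  refine forall_congr' fun p => ?_
  rw [← map_smul, Submodule.mkQ_apply, Submodule.mkQ_apply, Submodule.Quotient.mk_eq_zero,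
    Submodule.Quotient.mk_eq_zero]
  have : rs[i] • (Ideal.Quotient.mk I p) = Ideal.Quotient.mk I (rs[i] * p) := rfl
  rw [this, mk_mem_smul_top_iff, mk_mem_smul_top_iff]

theorem isRegular_quotient_iff (I : Ideal R) (rs : List R) :
    RingTheory.Sequence.IsRegular (R ⧸ I) rs ↔
      I.RegularModulo rs ∧ I ⊔ Ideal.ofList rs ≠ ⊤ := by
  rw [RingTheory.Sequence.isRegular_iff, isWeaklyRegular_quotient_iff]
  refine and_congr_right fun _ => not_congr ?_
  rw [eq_comm, Submodule.eq_top_iff', Ideal.Quotient.mk_surjective.forall, Submodule.eq_top_iff']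
  exact forall_congr' fun p => mk_mem_smul_top_iff I _ p

/-- A version of Nakayama's lemma: an element that maps `C` into `I + r C` belongs to every
prime containing `r` and the conductor of `C` into `I`. -/
theorem mem_of_mul_mem_sup {I C m : Ideal R} [m.IsPrime] {r z : R} (hC : C.FG) (hr : r ∈ m)
    (hz : ∀ c ∈ C, ∃ v ∈ C, z * c - r * v ∈ I) (hm : ∀ x, (∀ c ∈ C, x * c ∈ I) → x ∈ m) :
    z ∈ m := by
  let N : Submodule R (R ⧸ I) := Submodule.map (Submodule.mkQ I) C
  have : Module.Finite R N := Module.Finite.iff_fg.mpr (Submodule.FG.map _ hC)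
  have hN : LinearMap.range (LinearMap.lsmul R N z) ≤ Ideal.span {r} • ⊤ := by
    rintro _ ⟨⟨_, c, hc, rfl⟩, rfl⟩
    obtain ⟨v, hv, h⟩ := hz c hc
    have : (LinearMap.lsmul R N z) ⟨Submodule.mkQ I c, c, hc, rfl⟩ =
        r • (⟨Submodule.mkQ I v, v, hv, rfl⟩ : N) := by
      apply Subtype.ext
      change z • Submodule.mkQ I c = r • Submodule.mkQ I v
      rw [← map_smul, ← map_smul]
      exact (Submodule.Quotient.eq I).mpr h
    rw [this]
    exact Submodule.smul_mem_smul (Ideal.mem_span_singleton_self r) trivial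
  -- Cayley–Hamilton: `p(z)` kills `C` modulo `I`, so it lies in `m`. The lower coefficients of the
  -- monic `p` lie in `(r) ≤ m`, hence a power of `z` is in `m`.
  obtain ⟨p, hp, -, hc, h⟩ :=
    LinearMap.exists_monic_and_natDegree_eq_and_coeff_mem_pow_and_aeval_eq_zero R
      (LinearMap.lsmul R N z) (Ideal.span {r}) hN
  have hev : p.eval z ∈ m := by
    refine hm _ fun c hc => ?_
    have h1 : Polynomial.aeval (LinearMap.lsmul R N z) p = LinearMap.lsmul R N (p.eval z) := by
      have : LinearMap.lsmul R N z = algebraMap R (Module.End R N) z := rfl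
      rw [this, Polynomial.aeval_algebraMap_apply]
      simp [Polynomial.aeval_def]
      rfl
    have h2 := congrArg (fun f => (f ⟨Submodule.mkQ I c, c, hc, rfl⟩ : N).1) (h1.symm.trans h)
    have h3 : p.eval z • Submodule.mkQ I c = 0 := h2
    rw [← map_smul] at h3
    exact (Submodule.Quotient.mk_eq_zero I).mp h3
  rw [Polynomial.eval_eq_sum_range, Finset.sum_range_succ, hp.coeff_natDegree, one_mul] at hev
  have : ∑ i ∈ Finset.range p.natDegree, p.coeff i * z ^ i ∈ m := by
    refine Ideal.sum_mem _ fun i hi => Ideal.mul_mem_right _ _ ?_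
    have h1 : Ideal.span {r} ≤ m := (Ideal.span_singleton_le_iff_mem m).mpr hr
    exact h1 (Ideal.pow_le_self (by simp at hi; omega) (hc i))
  exact Ideal.IsPrime.mem_of_pow_mem ‹_› _ ((Ideal.add_mem_iff_right _ this).mp hev)

/-! ### Associated primes bound the length of regular sequences -/

/-- If `P` is an associated prime of `R ⧸ I` and `r` is regular on `R ⧸ I`, then some associated
prime of `R ⧸ (I + (r))` strictly contains `P`. -/
theorem exists_prime_colon_gt [IsNoetherianRing R] {I P m : Ideal R} [P.IsPrime] [m.IsPrime]
    {b r : R} (hP : ∀ x, x ∈ P ↔ x * b ∈ I) (hPm : P ≤ m) (hr : r ∈ m)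
    (hreg : ∀ p, r * p ∈ I → p ∈ I) :
    ∃ (Q : Ideal R) (c : R), Q.IsPrime ∧ P < Q ∧ Q ≤ m ∧
      ∀ x, x ∈ Q ↔ x * c ∈ I ⊔ Ideal.span {r} := by
  -- `C/I` is the part of `R/I` killed by `P`. Its image `N` in `R/(I + (r))` is still killed by
  -- `P`, and `Q` will be an associated prime of `N`.
  let C : Ideal R := Submodule.colon I (P : Set R)
  have memC : ∀ c, c ∈ C ↔ ∀ p ∈ P, c * p ∈ I := fun c => Submodule.mem_colon
  have hbC : b ∈ C := (memC b).mpr fun p hp => by rw [mul_comm]; exact (hP p).mp hp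
  let N : Submodule R (R ⧸ (I ⊔ Ideal.span {r})) :=
    Submodule.map (Submodule.mkQ (I ⊔ Ideal.span {r})) C
  have hann : ∀ z, z ∈ Module.annihilator R N ↔ ∀ c ∈ C, z * c ∈ I ⊔ Ideal.span {r} := by
    intro z
    rw [Module.mem_annihilator]
    constructor
    · intro h c hc
      have := congrArg Subtype.val (h ⟨Submodule.mkQ _ c, c, hc, rfl⟩)
      have h3 : z • Submodule.mkQ (I ⊔ Ideal.span {r}) c = 0 := this
      rw [← map_smul] at h3
      exact (Submodule.Quotient.mk_eq_zero _).mp h3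
    · rintro h ⟨_, c, hc, rfl⟩
      apply Subtype.ext
      change z • Submodule.mkQ (I ⊔ Ideal.span {r}) c = 0
      rw [← map_smul]
      exact (Submodule.Quotient.mk_eq_zero _).mpr (h c hc)
  have hle : Module.annihilator R N ≤ m := by
    intro z hz
    rw [hann] at hz
    refine mem_of_mul_mem_sup (I := I) (C := C) (r := r) (IsNoetherian.noetherian C) hr ?_ ?_
    -- Since `r` is regular modulo `I`, `z c = i + r v` forces `v ∈ C`; this is the hypothesis of
    -- the Nakayama argument.
    · intro c hc
      obtain ⟨i, hi, y, hy, h⟩ := Submodule.mem_sup.mp (hz c hc)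
      obtain ⟨v, rfl⟩ := Ideal.mem_span_singleton'.mp hy
      refine ⟨v, (memC v).mpr fun p hp => hreg _ ?_, ?_⟩
      · have : r * (v * p) = z * (c * p) - p * i := by
          linear_combination p * h
        rw [this]
        exact I.sub_mem (I.mul_mem_left _ ((memC c).mp hc p hp)) (I.mul_mem_left _ hi)
      · rw [← h]
        convert hi using 1
        ring
    · exact fun x hx => hPm ((hP x).mpr (hx b hbC))
  obtain ⟨Q, hQ, hQm⟩ := Ideal.exists_minimalPrimes_le hle
  have hQN : Module.annihilator R N ≤ Q := hQ.1.2
  have hQp : Q.IsPrime := hQ.1.1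
  obtain ⟨-, ⟨⟨_, c, hc, rfl⟩, hQc⟩⟩ := isAssociatedPrime_iff.mp
    (Module.associatedPrimes.minimalPrimes_annihilator_subset_associatedPrimes R N hQ)
  have memQ : ∀ x, x ∈ Q ↔ x * c ∈ I ⊔ Ideal.span {r} := by
    intro x
    rw [hQc, Submodule.mem_colon_singleton, Submodule.mem_bot, ← Subtype.coe_inj]
    change x • Submodule.mkQ (I ⊔ Ideal.span {r}) c = 0 ↔ _
    rw [← map_smul]
    exact Submodule.Quotient.mk_eq_zero _
  have hrr : r ∈ I ⊔ Ideal.span {r} := Ideal.mem_sup_right (Ideal.mem_span_singleton_self r)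
  refine ⟨Q, c, hQp, lt_of_le_of_ne ?_ ?_, hQm, memQ⟩
  · intro p hp
    rw [memQ, mul_comm]
    exact Ideal.mem_sup_left ((memC c).mp hc p hp)
  · rintro rfl
    have h1 : r ∈ P := (memQ r).mpr (Ideal.mul_mem_right _ _ hrr)
    have h2 : b ∈ I := hreg b ((hP r).mp h1)
    exact hQp.ne_top ((Ideal.eq_top_iff_one _).mpr ((hP 1).mpr (by rwa [one_mul])))

/-- The length of a regular sequence on `R ⧸ I` in the prime `m` is bounded by the difference of
the heights of a prime below `m` and of an associated prime of `R ⧸ I` in `m`. -/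
theorem RegularModulo.exists_height_add_length_le [IsNoetherianRing R] {I P m : Ideal R}
    [hPp : P.IsPrime] [m.IsPrime] {b : R} {rs : List R} (h : I.RegularModulo rs)
    (hP : ∀ x, x ∈ P ↔ x * b ∈ I) (hPm : P ≤ m) (hrs : ∀ r ∈ rs, r ∈ m) :
    ∃ Q : Ideal R, Q.IsPrime ∧ P.height + rs.length ≤ Q.height := by
  induction rs generalizing I P b with
  | nil => exact ⟨P, hPp, by simp⟩
  | cons r rs ih =>
    obtain ⟨Q, c, hQ, hlt, hQm, hc⟩ := exists_prime_colon_gt hP hPm (hrs r (by simp)) h.1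
    obtain ⟨Q', hQ', hle⟩ := ih h.2 hc hQm (fun r hr => hrs r (by simp [hr]))
    refine ⟨Q', hQ', le_trans ?_ hle⟩
    have := Ideal.height_add_one_le_of_lt_of_isPrime hlt
    calc P.height + ((r :: rs).length : ℕ∞) = P.height + 1 + rs.length := by
          push_cast [List.length_cons]; rw [add_assoc, add_comm 1]
      _ ≤ _ := by gcongr

end Ideal

/-! ### Complete homogeneous polynomials -/

/-- The complete homogeneous polynomials of a list of ring elements. -/
def completeHomogeneous {R : Type*} [CommRing R] : List R → ℕ → R
  | _, 0 => 1
  | [], _ + 1 => 0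
  | a :: l, k + 1 => completeHomogeneous l (k + 1) + a * completeHomogeneous (a :: l) k

section

variable {R S : Type*} [CommRing R] [CommRing S]

@[simp]
theorem completeHomogeneous_zero (l : List R) : completeHomogeneous l 0 = 1 := by
  cases l <;> rw [completeHomogeneous]

theorem completeHomogeneous_cons_succ (a : R) (l : List R) (k : ℕ) :
    completeHomogeneous (a :: l) (k + 1) =
      completeHomogeneous l (k + 1) + a * completeHomogeneous (a :: l) k := by
  rw [completeHomogeneous]

theorem map_completeHomogeneous (f : R →+* S) (l : List R) (k : ℕ) :
    f (completeHomogeneous l k) = completeHomogeneous (l.map f) k := by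
  induction l generalizing k with
  | nil => cases k <;> simp [completeHomogeneous]
  | cons a l ih =>
    induction k with
    | zero => simp
    | succ k ihk =>
      rw [List.map_cons, completeHomogeneous_cons_succ, completeHomogeneous_cons_succ, map_add,
        map_mul, ih, ihk, List.map_cons]

theorem completeHomogeneous_zero_cons (l : List R) (k : ℕ) :
    completeHomogeneous (0 :: l) k = completeHomogeneous l k := by
  cases k with
  | zero => simp
  | succ k => simp [completeHomogeneous_cons_succ]

theorem completeHomogeneous_mem {I : Ideal R} {l : List R} (h : ∀ a ∈ l, a ∈ I) (k : ℕ) :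
    completeHomogeneous l (k + 1) ∈ I := by
  induction l generalizing k with
  | nil => simp [completeHomogeneous]
  | cons a l ih =>
    rw [completeHomogeneous_cons_succ]
    exact I.add_mem (ih (fun b hb => h b (by simp [hb])) k) (I.mul_mem_right _ (h a (by simp)))

theorem monic_completeHomogeneous_X_cons (l : List R) (k : ℕ) :
    (completeHomogeneous (Polynomial.X :: l.map Polynomial.C) k).Monic := by
  nontriviality R
  suffices (completeHomogeneous (Polynomial.X :: l.map Polynomial.C) k).Monic ∧
      (completeHomogeneous (Polynomial.X :: l.map Polynomial.C) k).natDegree = k from this.1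
  induction k with
  | zero => simp
  | succ k ih =>
    rw [completeHomogeneous_cons_succ, ← map_completeHomogeneous]
    have h1 : (Polynomial.X * completeHomogeneous
        (Polynomial.X :: l.map Polynomial.C) k).Monic := Polynomial.monic_X.mul ih.1
    have h2 : (Polynomial.X * completeHomogeneous
        (Polynomial.X :: l.map Polynomial.C) k).natDegree = k + 1 := by
      rw [Polynomial.monic_X.natDegree_mul ih.1, ih.2, Polynomial.natDegree_X, add_comm]
    rw [add_comm, Polynomial.natDegree_add_C]
    refine ⟨h1.add_of_left ?_, h2⟩
    refine lt_of_le_of_lt Polynomial.degree_C_le ?_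
    rw [Polynomial.degree_eq_natDegree h1.ne_zero, h2]
    exact_mod_cast Nat.succ_pos k

/-! ### Lifting regularity from coefficients to polynomials -/

namespace Ideal

/-- Weak regularity holds on the zero module; this covers coefficient ideals that become the whole
ring. -/
theorem regularModulo_top (rs : List R) : (⊤ : Ideal R).RegularModulo rs := by
  induction rs with
  | nil => trivial
  | cons r rs ih => exact ⟨fun _ _ => trivial, by rwa [top_sup_eq]⟩

/-- Regularity modulo `I` follows from regularity modulo `I : x` and modulo `I + (x)`. -/
theorem RegularModulo.of_colon_of_sup {I J : Ideal R} {x : R} {rs : List R}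
    (hJ : ∀ p, p ∈ J ↔ x * p ∈ I) (h1 : J.RegularModulo rs)
    (h2 : (I ⊔ Ideal.span {x}).RegularModulo rs) : I.RegularModulo rs := by
  induction rs generalizing I J with
  | nil => trivial
  | cons r rs ih =>
    have hhead : ∀ p, r * p ∈ I ⊔ Ideal.span {x} → p ∈ I ⊔ Ideal.span {x} := h2.1
    refine ⟨fun p hp => ?_, ih (J := J ⊔ Ideal.span {r}) (fun q => ?_) h1.2 ?_⟩
    · obtain ⟨i, hi, y, hy, rfl⟩ := Submodule.mem_sup.mp (hhead p (Ideal.mem_sup_left hp))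
      obtain ⟨q, rfl⟩ := Ideal.mem_span_singleton'.mp hy
      refine I.add_mem hi ?_
      have : r * q ∈ J := by
        rw [hJ]
        have := I.sub_mem hp (I.mul_mem_left r hi)
        convert this using 1
        ring
      rw [mul_comm]
      exact (hJ q).mp (h1.1 q this)
    -- `(I + (r)) : x = (I : x) + (r)`; the inclusion from left to right uses that `r` is regular
    -- modulo `I + (x)`.
    · constructor
      · intro hq
        obtain ⟨j, hj, y, hy, rfl⟩ := Submodule.mem_sup.mp hq
        obtain ⟨v, rfl⟩ := Ideal.mem_span_singleton'.mp hy
        rw [mul_add]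
        refine add_mem (Ideal.mem_sup_left ((hJ j).mp hj)) (Ideal.mem_sup_right ?_)
        exact Ideal.mem_span_singleton'.mpr ⟨x * v, by ring⟩
      · intro hq
        obtain ⟨i, hi, y, hy, h⟩ := Submodule.mem_sup.mp hq
        obtain ⟨p, rfl⟩ := Ideal.mem_span_singleton'.mp hy
        have hp : p ∈ I ⊔ Ideal.span {x} := by
          refine hhead p ?_
          have : r * p = -i + q * x := by linear_combination h
          rw [this]
          exact add_mem (Ideal.mem_sup_left (I.neg_mem hi))
            (Ideal.mem_sup_right (Ideal.mem_span_singleton'.mpr ⟨q, rfl⟩))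
        obtain ⟨i', hi', y', hy', rfl⟩ := Submodule.mem_sup.mp hp
        obtain ⟨q', rfl⟩ := Ideal.mem_span_singleton'.mp hy'
        have hqq : q - r * q' ∈ J := by
          rw [hJ]
          have : x * (q - r * q') = i + i' * r := by linear_combination -h
          rw [this]
          exact I.add_mem hi (I.mul_mem_right _ hi')
        have : q = (q - r * q') + r * q' := by ring
        rw [this]
        exact add_mem (Ideal.mem_sup_left hqq)
          (Ideal.mem_sup_right (Ideal.mem_span_singleton'.mpr ⟨q', by ring⟩))
    · rw [sup_right_comm]
      exact h2.2

theorem regularModulo_comap_iff {f : R →+* S} (hf : Function.Surjective f) (I : Ideal S)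
    (rs : List R) : (I.comap f).RegularModulo rs ↔ I.RegularModulo (rs.map f) := by
  induction rs generalizing I with
  | nil => exact Iff.rfl
  | cons r rs ih =>
    have h : I.comap f ⊔ Ideal.span {r} = (I ⊔ Ideal.span {f r}).comap f := by
      have hI : (I ⊔ Ideal.span {f r}) = (I.comap f ⊔ Ideal.span {r}).map f := by
        rw [Ideal.map_sup, Ideal.map_comap_of_surjective f hf, Ideal.map_span, Set.image_singleton]
      rw [hI, Ideal.comap_map_of_surjective f hf]
      exact (sup_of_le_left ((Ideal.comap_mono bot_le).trans le_sup_left)).symm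
    rw [List.map_cons, RegularModulo, RegularModulo, h, ih]
    simp [hf.forall, Ideal.mem_comap]

/-- Regular sequences on `R ⧸ I` stay regular on `R[X] ⧸ (I, f)` for `f` monic. -/
theorem RegularModulo.map_C_sup_span_monic {I : Ideal R} {rs : List R} (h : I.RegularModulo rs)
    {f : Polynomial R} (hf : f.Monic) :
    (I.map Polynomial.C ⊔ Ideal.span {f}).RegularModulo (rs.map Polynomial.C) := by
  -- Remainders modulo the monic `f` are normal forms, and multiplication by a constant acts on them
  -- coefficientwise.
  have key : ∀ (I : Ideal R) (p : Polynomial R),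
      p ∈ I.map Polynomial.C ⊔ Ideal.span {f} ↔ p %ₘ f ∈ I.map Polynomial.C := by
    intro I p
    constructor
    · intro hp
      obtain ⟨g, hg, y, hy, rfl⟩ := Submodule.mem_sup.mp hp
      obtain ⟨v, rfl⟩ := Ideal.mem_span_singleton'.mp hy
      have h0 : (v * f) %ₘ f = 0 := (Polynomial.modByMonic_eq_zero_iff_dvd hf).mpr ⟨v, mul_comm _ _⟩
      rw [Polynomial.add_modByMonic, h0, add_zero]
      rw [← Ideal.mk_ker (I := I), ← Polynomial.ker_mapRingHom, RingHom.mem_ker] at hg ⊢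
      rw [Polynomial.coe_mapRingHom, Polynomial.map_modByMonic _ hf, ← Polynomial.coe_mapRingHom,
        hg, Polynomial.zero_modByMonic]
    · intro hp
      rw [← Polynomial.modByMonic_add_div p f]
      exact add_mem (Ideal.mem_sup_left hp)
        (Ideal.mem_sup_right (Ideal.mem_span_singleton'.mpr ⟨_, mul_comm _ _⟩))
  induction rs generalizing I with
  | nil => trivial
  | cons r rs ih =>
    refine ⟨fun p hp => ?_, ?_⟩
    · rw [key] at hp ⊢
      rw [← Polynomial.smul_eq_C_mul, Polynomial.smul_modByMonic, Polynomial.smul_eq_C_mul,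
        Ideal.mem_map_C_iff] at hp
      rw [Ideal.mem_map_C_iff]
      intro n
      refine h.1 _ ?_
      simpa using hp n
    · have := ih h.2
      rw [Ideal.map_sup, Ideal.map_span, Set.image_singleton, sup_right_comm] at this
      exact this

/-- Modulo `h_s(X, l)` the recursion gives `h_{s+1}(X, l) ≡ h_{s+1}(l)`. Adjoining either one yields
the same ideal, so the replacement continues along the window. -/
theorem regularModulo_completeHomogeneous_map_C_sup {I : Ideal (Polynomial R)} {l : List R}
    {s r : ℕ} (hI : completeHomogeneous (Polynomial.X :: l.map Polynomial.C) s ∈ I)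
    (h : I.RegularModulo (((List.range' (s + 1) r).map (completeHomogeneous l)).map Polynomial.C)) :
    I.RegularModulo ((List.range' (s + 1) r).map
      (completeHomogeneous (Polynomial.X :: l.map Polynomial.C))) := by
  induction r generalizing I s with
  | zero => trivial
  | succ r ih =>
    rw [List.range'_succ, List.map_cons, List.map_cons] at h
    rw [List.range'_succ, List.map_cons]
    have e : completeHomogeneous (Polynomial.X :: l.map Polynomial.C) (s + 1) =
        Polynomial.C (completeHomogeneous l (s + 1)) + Polynomial.X *
          completeHomogeneous (Polynomial.X :: l.map Polynomial.C) s := by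
      rw [completeHomogeneous_cons_succ, map_completeHomogeneous]
    have hX := I.mul_mem_left Polynomial.X hI
    have hsup : I ⊔ Ideal.span {completeHomogeneous (Polynomial.X :: l.map Polynomial.C) (s + 1)} =
        I ⊔ Ideal.span {Polynomial.C (completeHomogeneous l (s + 1))} := by
      apply le_antisymm <;> refine sup_le le_sup_left ?_ <;>
        rw [Ideal.span_singleton_le_iff_mem]
      · rw [e]
        exact add_mem (Ideal.mem_sup_right (Ideal.mem_span_singleton_self _))
          (Ideal.mem_sup_left hX)
      · rw [← sub_eq_of_eq_add e]
        exact sub_mem (Ideal.mem_sup_right (Ideal.mem_span_singleton_self _))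
          (Ideal.mem_sup_left hX)
    refine ⟨fun p hp => h.1 p ?_, ?_⟩
    · rw [e, add_mul] at hp
      exact (I.add_mem_iff_left (I.mul_mem_right _ hX)).mp hp
    · refine ih (Ideal.mem_sup_right (Ideal.mem_span_singleton_self _)) ?_
      rw [hsup]
      exact h.2

theorem regularModulo_completeHomogeneous_map_C {I : Ideal R} {l : List R} {s r : ℕ}
    (h : I.RegularModulo ((List.range' (s + 2) r).map (completeHomogeneous l))) :
    (I.map Polynomial.C).RegularModulo ((List.range' (s + 1) (r + 1)).map
      (completeHomogeneous (Polynomial.X :: l.map Polynomial.C))) := by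
  have hm := monic_completeHomogeneous_X_cons l (s + 1)
  rw [List.range'_succ, List.map_cons]
  refine ⟨fun p hp => ?_, ?_⟩
  · rw [← Ideal.mk_ker (I := I), ← Polynomial.ker_mapRingHom, RingHom.mem_ker] at hp ⊢
    rw [map_mul] at hp
    exact ((hm.map (Ideal.Quotient.mk I)).mul_right_eq_zero_iff).mp hp
  · exact regularModulo_completeHomogeneous_map_C_sup
      (Ideal.mem_sup_right (Ideal.mem_span_singleton_self _)) (h.map_C_sup_span_monic hm)

/-- Lifts regularity from coefficient ideals to the ideal of polynomials with coefficients in an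
increasing sequence of ideals that is constant from the index `E` on. -/
theorem regularModulo_completeHomogeneous_of_coeff {c : ℕ → Ideal R} (hc : Monotone c) {E : ℕ}
    {J : Ideal (Polynomial R)} (hJ : ∀ p, p ∈ J ↔ ∀ j, p.coeff j ∈ c (min j E)) {l : List R}
    {s r : ℕ}
    (h1 : ∀ j < E, (c j).RegularModulo ((List.range' (s + 1) (r + 1)).map (completeHomogeneous l)))
    (h2 : (c E).RegularModulo ((List.range' (s + 2) r).map (completeHomogeneous l))) :
    J.RegularModulo ((List.range' (s + 1) (r + 1)).map
      (completeHomogeneous (Polynomial.X :: l.map Polynomial.C))) := by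
  induction E generalizing c J with
  | zero =>
    have : J = (c 0).map Polynomial.C := by
      ext p
      rw [hJ, Ideal.mem_map_C_iff]
      simp
    rw [this]
    exact regularModulo_completeHomogeneous_map_C h2
  | succ E ih =>
    -- Passing to `J : X` shifts the coefficient ideals by one and lowers `E`; `J + (X)` is the
    -- preimage of `c 0` under `X ↦ 0`.
    refine RegularModulo.of_colon_of_sup (x := Polynomial.X)
      (J := Submodule.colon J {Polynomial.X})
      (fun p => by rw [Submodule.mem_colon_singleton, smul_eq_mul, mul_comm]) ?_ ?_
    · refine ih (c := fun j => c (j + 1)) (fun i j hij => hc (by omega)) (fun p => ?_)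
        (fun j hj => h1 (j + 1) (by omega)) h2
      rw [Submodule.mem_colon_singleton, smul_eq_mul, hJ]
      constructor
      · intro h j
        have := h (j + 1)
        rw [Polynomial.coeff_mul_X] at this
        rwa [← Nat.add_min_add_right]
      · intro h j
        cases j with
        | zero => simp
        | succ j =>
          rw [Polynomial.coeff_mul_X, Nat.add_min_add_right]
          exact h j
    · have : J ⊔ Ideal.span {Polynomial.X} = (c 0).comap (Polynomial.evalRingHom 0) := by
        apply le_antisymm
        · refine sup_le (fun p hp => ?_) ?_
          · have := (hJ p).mp hp 0
            rw [Ideal.mem_comap, Polynomial.coe_evalRingHom, ← Polynomial.coeff_zero_eq_eval_zero]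
            simpa using this
          · rw [Ideal.span_singleton_le_iff_mem, Ideal.mem_comap]
            simp
        · intro p hp
          rw [Ideal.mem_comap, Polynomial.coe_evalRingHom,
            ← Polynomial.coeff_zero_eq_eval_zero] at hp
          rw [← Polynomial.X_mul_divX_add p]
          refine add_mem (Ideal.mem_sup_right (Ideal.mul_mem_right _ _
            (Ideal.mem_span_singleton_self _))) (Ideal.mem_sup_left ((hJ _).mpr fun j => ?_))
          rw [Polynomial.coeff_C]
          split_ifs
          · exact hc (Nat.zero_le _) hp
          · exact zero_mem _
      rw [this, regularModulo_comap_iff (fun a => ⟨Polynomial.C a, by simp⟩)]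
      have hm : (Polynomial.evalRingHom (0 : R)) ∘
          (completeHomogeneous (Polynomial.X :: l.map Polynomial.C)) = completeHomogeneous l := by
        funext k
        rw [Function.comp_apply, map_completeHomogeneous]
        simp [completeHomogeneous_zero_cons, Function.comp_def]
      rw [List.map_map, hm]
      exact h1 0 (Nat.succ_pos E)

end Ideal
end

/-! ### Ideals of Veronese type -/

section

variable {K : Type*} [Field K]

/-- Greedy choice: take as much as possible from the first coordinate. -/
theorem exists_le_sum_eq {n d : ℕ} (u : Fin n → ℕ) (h : d ≤ ∑ i, u i) :
    ∃ a : Fin n → ℕ, (∀ i, a i ≤ u i) ∧ ∑ i, a i = d := by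
  induction n generalizing d with
  | zero => exact ⟨u, fun _ => le_rfl, by simp at h ⊢; omega⟩
  | succ n ih =>
    rw [Fin.sum_univ_succ] at h
    obtain ⟨a, ha, hd⟩ := ih (d := d - min d (u 0)) (fun i => u i.succ) (by omega)
    refine ⟨Fin.cons (min d (u 0)) a, fun i => ?_, ?_⟩
    · refine Fin.cases ?_ (fun i => ?_) i
      · simp
      · simpa using ha i
    · rw [Fin.sum_univ_succ]
      simp only [Fin.cons_zero, Fin.cons_succ, hd]
      omega

theorem mem_veroneseTypeIdeal {n d : ℕ} {e : Fin n → ℕ} {p : MvPolynomial (Fin n) K} :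
    p ∈ veroneseTypeIdeal K d e ↔ ∀ u ∈ p.support, d ≤ ∑ i, min (u i) (e i) := by
  have h : veroneseTypeIdeal K d e = Ideal.span ((fun a => MvPolynomial.monomial a (1 : K)) ''
      {a : Fin n →₀ ℕ | ∑ i, a i = d ∧ ∀ i, a i ≤ e i}) := by
    rw [veroneseTypeIdeal]
    congr 1
    ext u
    constructor
    · rintro ⟨a, h1, h2, rfl⟩
      exact ⟨a, ⟨h1, h2⟩, rfl⟩
    · rintro ⟨a, ⟨h1, h2⟩, rfl⟩
      exact ⟨a, h1, h2, rfl⟩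
  rw [h, MvPolynomial.mem_ideal_span_monomial_image]
  refine forall₂_congr fun u _ => ?_
  constructor
  · rintro ⟨a, ⟨h1, h2⟩, h3⟩
    rw [← h1]
    exact Finset.sum_le_sum fun i _ => le_min (h3 i) (h2 i)
  · intro hu
    obtain ⟨a, ha, hd⟩ := exists_le_sum_eq _ hu
    refine ⟨Finsupp.equivFunOnFinite.symm a, ⟨by simpa using hd, fun i => ?_⟩, fun i => ?_⟩
    · simpa using (ha i).trans (min_le_right _ _)
    · simpa using (ha i).trans (min_le_left _ _)

theorem veroneseTypeIdeal_zero {n : ℕ} (e : Fin n → ℕ) : veroneseTypeIdeal K 0 e = ⊤ := by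
  rw [Ideal.eq_top_iff_one, mem_veroneseTypeIdeal]
  exact fun _ _ => Nat.zero_le _

theorem veroneseTypeIdeal_antitone {n d d' : ℕ} (h : d ≤ d') (e : Fin n → ℕ) :
    veroneseTypeIdeal K d' e ≤ veroneseTypeIdeal K d e := fun p hp => by
  rw [mem_veroneseTypeIdeal] at hp ⊢
  exact fun u hu => h.trans (hp u hu)

theorem veroneseTypeIdeal_eq_bot {n d : ℕ} {e : Fin n → ℕ} (h : ∑ i, e i < d) :
    veroneseTypeIdeal K d e = ⊥ := by
  rw [eq_bot_iff]
  intro p hp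
  rw [mem_veroneseTypeIdeal] at hp
  rw [Ideal.mem_bot, ← MvPolynomial.support_eq_empty, Finset.eq_empty_iff_forall_notMem]
  intro u hu
  have := (hp u hu).trans (Finset.sum_le_sum fun i _ => min_le_right (u i) (e i))
  omega

theorem mem_veroneseTypeIdeal_succ_iff {n d : ℕ} {e : Fin (n + 1) → ℕ}
    {p : MvPolynomial (Fin (n + 1)) K} :
    p ∈ veroneseTypeIdeal K d e ↔ ∀ j, (MvPolynomial.finSuccEquiv K n p).coeff j ∈
      veroneseTypeIdeal K (d - min j (e 0)) (Fin.tail e) := by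
  simp only [mem_veroneseTypeIdeal, MvPolynomial.mem_support_coeff_finSuccEquiv]
  constructor
  · intro h j u hu
    have := h _ hu
    rw [Fin.sum_univ_succ] at this
    simp only [Finsupp.cons_zero, Finsupp.cons_succ] at this
    simp only [Fin.tail]
    omega
  · intro h u hu
    have := h (u 0) (Finsupp.tail u) (by rwa [Finsupp.cons_tail])
    rw [Fin.sum_univ_succ]
    simp only [Finsupp.tail_apply, Fin.tail] at this
    omega

/-- Consecutive complete homogeneous polynomials form a regular sequence modulo an ideal of
Veronese type. -/
theorem regularModulo_veroneseTypeIdeal {n d r : ℕ} {e : Fin n → ℕ} (hr : r ≤ n)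
    (h : r + ∑ i, e i + 1 ≤ d + n) (s : ℕ) :
    (veroneseTypeIdeal K d e).RegularModulo ((List.range' (s + 1) r).map
      (completeHomogeneous (List.ofFn MvPolynomial.X))) := by
  induction n generalizing d r s with
  | zero =>
    obtain rfl : r = 0 := by omega
    trivial
  | succ n ih =>
    -- If `r = n + 1`, the numerical hypothesis makes the ideal zero, so `e` may be replaced by `0`.
    -- Then no index `j < e 0` remains, and only `n` elements are needed in fewer variables.
    wlog hrn : r ≤ n ∨ e 0 = 0 generalizing e
    · have h1 : ∑ i, e i < d := by omega
      have h2 : ∑ i : Fin (n + 1), (0 : Fin (n + 1) → ℕ) i < d := by simp; omega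
      rw [veroneseTypeIdeal_eq_bot h1, ← veroneseTypeIdeal_eq_bot h2]
      exact this (by simp; omega) (Or.inr rfl)
    rw [Fin.sum_univ_succ] at h
    have htail : ∑ i, Fin.tail e i = ∑ i : Fin n, e i.succ := rfl
    cases r with
    | zero => trivial
    | succ r =>
      let φ : MvPolynomial (Fin (n + 1)) K →+* Polynomial (MvPolynomial (Fin n) K) :=
        (MvPolynomial.finSuccEquiv K n :
          MvPolynomial (Fin (n + 1)) K →+* Polynomial (MvPolynomial (Fin n) K))
      have hφ : Function.Surjective φ := (MvPolynomial.finSuccEquiv K n).surjective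
      let J := (veroneseTypeIdeal K d e).comap
        ((MvPolynomial.finSuccEquiv K n).symm :
          Polynomial (MvPolynomial (Fin n) K) →+* MvPolynomial (Fin (n + 1)) K)
      have hJ : veroneseTypeIdeal K d e = J.comap φ := by
        ext p
        simp [J, φ, Ideal.mem_comap]
      have hl : φ ∘ completeHomogeneous (List.ofFn MvPolynomial.X) =
          completeHomogeneous (Polynomial.X ::
            (List.ofFn (MvPolynomial.X (R := K) (σ := Fin n))).map Polynomial.C) := by
        funext k
        rw [Function.comp_apply, map_completeHomogeneous, List.ofFn_succ]
        simp [φ, List.map_ofFn, Function.comp_def, MvPolynomial.finSuccEquiv_X_zero,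
          MvPolynomial.finSuccEquiv_X_succ]
      rw [hJ, Ideal.regularModulo_comap_iff hφ, List.map_map, hl]
      refine Ideal.regularModulo_completeHomogeneous_of_coeff
        (c := fun j => veroneseTypeIdeal K (d - j) (Fin.tail e)) (E := e 0)
        (fun i j hij => veroneseTypeIdeal_antitone (by omega) _) (fun p => ?_)
        (fun j hj => ?_) ?_
      · rw [Ideal.mem_comap, mem_veroneseTypeIdeal_succ_iff]
        simp
      · rcases le_or_gt d j with hd | hd
        · rw [Nat.sub_eq_zero_of_le hd, veroneseTypeIdeal_zero]
          exact Ideal.regularModulo_top _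
        · exact ih (by omega) (by omega) s
      · rcases le_or_gt d (e 0) with hd | hd
        · rw [Nat.sub_eq_zero_of_le hd, veroneseTypeIdeal_zero]
          exact Ideal.regularModulo_top _
        · exact ih (by omega) (by omega) (s + 1)

/-! ### Primes generated by variables -/

namespace MvPolynomial

variable {n : ℕ}

theorem mem_span_X_image_iff_aeval (A : Finset (Fin n)) (p : MvPolynomial (Fin n) K) :
    p ∈ Ideal.span (X '' (A : Set (Fin n)) : Set (MvPolynomial (Fin n) K)) ↔
      aeval (fun i => if i ∈ A then (0 : MvPolynomial (Fin n) K) else X i) p = 0 := by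
  let φ : MvPolynomial (Fin n) K →ₐ[K] MvPolynomial (Fin n) K :=
    aeval (fun i => if i ∈ A then (0 : MvPolynomial (Fin n) K) else X i)
  set P := Ideal.span (X '' (A : Set (Fin n)) : Set (MvPolynomial (Fin n) K)) with hP
  change _ ↔ φ p = 0
  constructor
  · have : P ≤ RingHom.ker φ := by
      rw [hP, Ideal.span_le]
      rintro _ ⟨i, hi, rfl⟩
      simp only [SetLike.mem_coe, RingHom.mem_ker, φ, aeval_X]
      exact if_pos hi
    exact fun h => this h
  · intro h
    have hmk : (Ideal.Quotient.mkₐ K P).comp φ = Ideal.Quotient.mkₐ K P := by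
      refine algHom_ext fun i => ?_
      simp only [AlgHom.comp_apply, φ, aeval_X]
      split_ifs with hi
      · rw [map_zero, eq_comm]
        exact Ideal.Quotient.eq_zero_iff_mem.mpr (Ideal.subset_span ⟨i, hi, rfl⟩)
      · rfl
    have := DFunLike.congr_fun hmk p
    rw [AlgHom.comp_apply, h, map_zero] at this
    exact Ideal.Quotient.eq_zero_iff_mem.mp this.symm

theorem isPrime_span_X_image (A : Finset (Fin n)) :
    (Ideal.span (X '' (A : Set (Fin n)) : Set (MvPolynomial (Fin n) K))).IsPrime := by
  have : Ideal.span (X '' (A : Set (Fin n)) : Set (MvPolynomial (Fin n) K)) = RingHom.ker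
      (aeval (R := K) (fun i => if i ∈ A then (0 : MvPolynomial (Fin n) K) else X i)) := by
    ext p
    rw [mem_span_X_image_iff_aeval, RingHom.mem_ker]
  rw [this]
  exact RingHom.ker_isPrime _

theorem card_le_height_span_X_image (A : Finset (Fin n)) :
    (A.card : ℕ∞) ≤
      (Ideal.span (X '' (A : Set (Fin n)) : Set (MvPolynomial (Fin n) K))).height := by
  induction A using Finset.induction_on with
  | empty => simp
  | insert a A ha ih =>
    have := isPrime_span_X_image (K := K) A
    have := isPrime_span_X_image (K := K) (insert a A)
    have hlt : Ideal.span (X '' (A : Set (Fin n)) : Set (MvPolynomial (Fin n) K)) <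
        Ideal.span (X '' ((insert a A : Finset (Fin n)) : Set (Fin n))) := by
      refine lt_of_le_not_ge (Ideal.span_mono (Set.image_mono (by simp))) fun hle => ?_
      have h : (X a : MvPolynomial (Fin n) K) ∈
          Ideal.span (X '' (A : Set (Fin n)) : Set (MvPolynomial (Fin n) K)) :=
        hle (Ideal.subset_span ⟨a, by simp, rfl⟩)
      rw [mem_span_X_image_iff_aeval, aeval_X, if_neg ha] at h
      exact X_ne_zero a h
    rw [Finset.card_insert_of_notMem ha, Nat.cast_add, Nat.cast_one]
    exact le_trans (by gcongr) (Ideal.height_add_one_le_of_lt_of_isPrime hlt)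

theorem height_le_of_isPrime (Q : Ideal (MvPolynomial (Fin n) K)) [Q.IsPrime] :
    Q.height ≤ n := by
  have h := Ideal.height_le_ringKrullDim_of_isPrime (I := Q)
  rw [ringKrullDim_of_isNoetherianRing, ringKrullDim_eq_zero_of_field, zero_add,
    Nat.card_eq_fintype_card, Fintype.card_fin] at h
  exact_mod_cast h

theorem idealOfVars_eq_span_X_image_univ :
    idealOfVars (Fin n) K = Ideal.span (X '' ((Finset.univ : Finset (Fin n)) : Set (Fin n))) := by
  simp [idealOfVars]

end MvPolynomial

/-! ### An associated prime of the required height -/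

/-- If `x^b` just fails to lie in the ideal of Veronese type, the colon ideal by `x^b` is generated
by the variables whose exponent in `b` is not maximal. -/
theorem mul_monomial_mem_veroneseTypeIdeal_iff {n d : ℕ} {e : Fin n → ℕ} {A : Finset (Fin n)}
    {b : Fin n →₀ ℕ} (hbA : ∀ i ∈ A, b i < e i) (hb : ∀ i ∉ A, b i = e i)
    (hlt : ∑ i, b i < d) (hge : A.Nonempty → d ≤ ∑ i, b i + 1) (p : MvPolynomial (Fin n) K) :
    p ∈ Ideal.span (MvPolynomial.X '' (A : Set (Fin n)) : Set (MvPolynomial (Fin n) K)) ↔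
      p * MvPolynomial.monomial b 1 ∈ veroneseTypeIdeal K d e := by
  rw [MvPolynomial.mem_ideal_span_X_image, mem_veroneseTypeIdeal]
  have hsupp : ∀ u, u ∈ (p * MvPolynomial.monomial b (1 : K)).support ↔
      ∃ m ∈ p.support, m + b = u := by
    intro u
    rw [MvPolynomial.mem_support_iff, MvPolynomial.coeff_mul_monomial', mul_one]
    constructor
    · intro h
      have hbu : b ≤ u := by
        by_contra hbu
        exact h (if_neg hbu)
      rw [if_pos hbu] at h
      exact ⟨u - b, MvPolynomial.mem_support_iff.mpr h, tsub_add_cancel_of_le hbu⟩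
    · rintro ⟨m, hm, rfl⟩
      rw [if_pos le_add_self, add_tsub_cancel_right]
      exact MvPolynomial.mem_support_iff.mp hm
  constructor
  · intro h u hu
    obtain ⟨m, hm, rfl⟩ := (hsupp u).mp hu
    obtain ⟨i, hi, hmi⟩ := h m hm
    refine (hge ⟨i, hi⟩).trans (Nat.succ_le_of_lt (Finset.sum_lt_sum (fun j _ => ?_)
      ⟨i, Finset.mem_univ _, ?_⟩))
    · by_cases hj : j ∈ A
      · have := hbA j hj
        simp; omega
      · have := hb j hj
        simp; omega
    · have := hbA i hi
      simp; omega
  · intro h m hm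
    by_contra! hne
    have h1 := h _ ((hsupp _).mpr ⟨m, hm, rfl⟩)
    have : ∑ i, min ((m + b) i) (e i) ≤ ∑ i, b i := by
      refine Finset.sum_le_sum fun i _ => ?_
      by_cases hi : i ∈ A
      · have := hne i hi
        simp [this]
      · rw [hb i hi]
        exact min_le_right _ _
    omega

/-- If `k < n`, any `A` of size `n - k` works: `b` is maximal off `A`, at most `e i - 1` on `A`, and
of total degree `d - 1`. This degree is attainable because `k` is the maximum of `0` and `d + n - 1
- ∑ e i`. If `k = n`, then `A` is empty and `b = e`, of degree below `d`. -/
theorem exists_exponent_of_card {n d k : ℕ} {e : Fin n → ℕ} (hd : 1 ≤ d)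
    (he : ∀ i, 1 ≤ e i) (hk : (k : ℤ) = min (n : ℤ) (max 0 (d + n - 1 - ∑ i, (e i : ℤ)))) :
    ∃ (A : Finset (Fin n)) (b : Fin n →₀ ℕ), A.card + k = n ∧ (∀ i ∈ A, b i < e i) ∧
      (∀ i ∉ A, b i = e i) ∧ ∑ i, b i < d ∧ (A.Nonempty → d ≤ ∑ i, b i + 1) := by
  rw [← Nat.cast_sum] at hk
  obtain hkn | hkn : n = k ∨ k < n := by omega
  · refine ⟨∅, Finsupp.equivFunOnFinite.symm e, by simp [hkn], by simp, by simp, ?_, by simp⟩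
    by_cases hn : n = 0
    · subst hn
      simp
      omega
    · simp
      omega
  · obtain ⟨A, -, hA⟩ := Finset.exists_subset_card_eq (s := (Finset.univ : Finset (Fin n)))
      (n := n - k) (by simp)
    have hsum : ∑ i, (if i ∈ A then e i - 1 else 0) + A.card +
        ∑ i, (if i ∈ A then 0 else e i) = ∑ i, e i := by
      have : A.card = ∑ i, if i ∈ A then 1 else 0 := by simp
      rw [this, ← Finset.sum_add_distrib, ← Finset.sum_add_distrib]
      refine Finset.sum_congr rfl fun i _ => ?_
      have := he i
      split_ifs <;> omega
    have hle : ∑ i, (if i ∈ A then 0 else e i) ≤ d - 1 := by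
      rcases Nat.eq_zero_or_pos k with h0 | h0
      · have : A = Finset.univ := by
          rw [← Finset.card_eq_iff_eq_univ, hA, h0]
          simp
        simp [this]
      · omega
    obtain ⟨a, ha, had⟩ := exists_le_sum_eq (d := d - 1 - ∑ i, (if i ∈ A then 0 else e i))
      (fun i => if i ∈ A then e i - 1 else 0) (by omega)
    have hb : ∑ i, (a i + if i ∈ A then 0 else e i) = d - 1 := by
      rw [Finset.sum_add_distrib]
      omega
    refine ⟨A, Finsupp.equivFunOnFinite.symm (fun i => a i + if i ∈ A then 0 else e i), by omega,
      fun i hi => ?_, fun i hi => ?_, ?_, fun _ => ?_⟩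
    · have h1 := ha i
      have h2 := he i
      rw [if_pos hi] at h1
      rw [Finsupp.equivFunOnFinite_symm_apply_apply, if_pos hi]
      omega
    · have := ha i
      simp only [hi, if_false] at this
      simp [hi]
      omega
    · simp only [Finsupp.equivFunOnFinite_symm_apply_apply]
      omega
    · simp only [Finsupp.equivFunOnFinite_symm_apply_apply]
      omega

end

/-! ### The depth formula -/

theorem theorem3p2 (K : Type*) [Field K] (n d : ℕ) (e : Fin n → ℕ) (hd : 1 ≤ d)
    (he_pos : ∀ i, 1 ≤ e i) (he_mono : Monotone e) (he_le : ∀ i, e i ≤ d) (t : ℤ)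
    (ht : t = (d : ℤ) + (n : ℤ) - 1 - ∑ i, (e i : ℤ)) :
    ∃ k : ℕ,
      moduleDepth (MvPolynomial.idealOfVars (Fin n) K)
        (MvPolynomial (Fin n) K ⧸ veroneseTypeIdeal K d e) = (k : ℕ∞) ∧
      (k : ℤ) = min (n : ℤ) (max 0 t) := by
  obtain ⟨k, hk⟩ : ∃ k : ℕ, (k : ℤ) = min (n : ℤ) (max 0 t) :=
    ⟨(min (n : ℤ) (max 0 t)).toNat, by omega⟩
  refine ⟨k, le_antisymm ?_ ?_, hk⟩
  · refine iSup_le ?_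
    rintro ⟨rs, hrs, hreg⟩
    obtain ⟨A, b, hA, h1, h2, h3, h4⟩ := exists_exponent_of_card hd he_pos (ht ▸ hk)
    have := MvPolynomial.isPrime_span_X_image (K := K) A
    have := MvPolynomial.isPrime_span_X_image (K := K) (Finset.univ : Finset (Fin n))
    rw [MvPolynomial.idealOfVars_eq_span_X_image_univ] at hrs
    obtain ⟨Q, hQ, hle⟩ :=
      ((Ideal.isRegular_quotient_iff _ _).mp hreg).1.exists_height_add_length_le
        (mul_monomial_mem_veroneseTypeIdeal_iff h1 h2 h3 h4)
        (Ideal.span_mono (Set.image_mono (by simp))) hrs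
    have h5 : ((A.card + rs.length : ℕ) : ℕ∞) ≤ n := by
      rw [Nat.cast_add]
      exact (add_le_add_left (MvPolynomial.card_le_height_span_X_image A) _).trans
        (hle.trans (MvPolynomial.height_le_of_isPrime Q))
    have h6 : A.card + rs.length ≤ n := by exact_mod_cast h5
    have : rs.length ≤ k := by omega
    exact_mod_cast this
  · let rs : List (MvPolynomial (Fin n) K) := (List.range' (0 + 1) k).map
      (completeHomogeneous (List.ofFn MvPolynomial.X))
    have hmem : ∀ r ∈ rs, r ∈ MvPolynomial.idealOfVars (Fin n) K := by
      intro r hr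
      obtain ⟨i, hi, rfl⟩ := List.mem_map.mp hr
      obtain ⟨j, rfl⟩ : ∃ j, i = j + 1 := ⟨i - 1, by simp at hi; omega⟩
      refine completeHomogeneous_mem (fun a ha => ?_) j
      obtain ⟨i, rfl⟩ := (List.mem_ofFn' _ _).mp ha
      exact Ideal.subset_span ⟨i, rfl⟩
    have hreg : RingTheory.Sequence.IsRegular
        (MvPolynomial (Fin n) K ⧸ veroneseTypeIdeal K d e) rs := by
      rw [Ideal.isRegular_quotient_iff]
      rw [← Nat.cast_sum] at ht
      constructor
      -- For `k = 0` the number `t` may be negative, and the numerical hypothesis of the regularity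
      -- theorem can fail.
      · rcases Nat.eq_zero_or_pos k with h0 | h0
        · simp only [rs, h0]
          trivial
        · exact regularModulo_veroneseTypeIdeal (by omega) (by omega) 0
      · have hprime := MvPolynomial.isPrime_span_X_image (K := K) (Finset.univ : Finset (Fin n))
        rw [← MvPolynomial.idealOfVars_eq_span_X_image_univ] at hprime
        refine ne_top_of_le_ne_top hprime.ne_top (sup_le ?_ (Ideal.span_le.mpr hmem))
        -- `I` lies in the maximal ideal because its generators have degree `d ≥ 1`.
        intro p hp
        rw [mem_veroneseTypeIdeal] at hp
        rw [MvPolynomial.idealOfVars_eq_span_X_image_univ, MvPolynomial.mem_ideal_span_X_image]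
        intro u hu
        by_contra! h
        have := hp u hu
        simp at h
        simp [h] at this
        omega
    rw [moduleDepth]
    have := le_iSup (fun rs : {rs : List (MvPolynomial (Fin n) K) //
      (∀ r ∈ rs, r ∈ MvPolynomial.idealOfVars (Fin n) K) ∧ RingTheory.Sequence.IsRegular
        (MvPolynomial (Fin n) K ⧸ veroneseTypeIdeal K d e) rs} => (rs.1.length : ℕ∞))
      ⟨rs, hmem, hreg⟩
    simpa [rs] using this
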